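/- **Theorem.** Let $R=\mathbb{R}[x_1,\dots,x_n]$ and let $R_d$ be the space of polynomials of degree $\le d$. Let $A\subset\mathbb{N}^n$ be finite, let $V\subset R$ be the space spanned by the monomials $\mathbf{x}^\alpha$, $\alpha\in A$, let $\deg V=\max_{\alpha\in A}|\alpha|$ ($0$ if $A=\emptyset$), and let $\mathbf{i}\in V^*$ be a linear form, with moments $\mathbf{i}_\alpha=\langle\mathbf{i}\mid\mathbf{x}^\alpha\rangle$, $\alpha\in A$ (for example $\langle \mathbf{i}\mid v\rangle=I[v]=\int_\Omega w\,v\,d\mathbf{x}$). For $k\in\mathbb{N}$ and $\sigma\in R_{2k}^*$ let $H_\sigma:R_k\to R_k^*$, $H_\sigma(p)(q)=\langle\sigma\mid pq\rangle$, be the truncated Hankel operator; write $H_\sigma\succcurlyeq 0$ if $\langle\sigma\mid p^2\rangle\ge 0$ for all $p\in R_k$, and write $H_\sigma$ also for its matrix $(\langle\sigma\mid\mathbf{x}^{\alpha+\beta}\rangle)_{|\alpha|,|\beta|\le k}$ in the monomial basis. Let $$\mathcal{H}^k(\mathbf{i})=\{H_\sigma\mid \sigma\in R_{2k}^*,\ \langle\sigma\mid\mathbf{x}^\alpha\rangle=\mathbf{i}_\alpha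 \text{ for } \alpha\in A,\ H_\sigma\succcurlyeq 0\},$$ and for $r\in\mathbb{N}$ let $\mathcal{E}^k_r(\mathbf{i})$ be the set of those $H_\sigma\in\mathcal{H}^k(\mathbf{i})$ for which $\sigma=\sum_{j=1}^r\omega_j\mathbf{e}_{\zeta_j}$ on $R_{2k}$ for some $\omega_j>0$ and $\zeta_j\in\mathbb{R}^n$, where $\mathbf{e}_\zeta(f)=f(\zeta)$. Let $s_k=\dim R_k$, let $\mathbf{x}^{(k)}$ be the vector of all monomials of degree $\le k$, and let $P\in\mathbb{R}^{s_k\times s_k}$ be a proper matrix, meaning that the homogeneous component of degree $2k$ of the polynomial $q(\mathbf{x})=(\mathbf{x}^{(k)})^tPP^t\mathbf{x}^{(k)}$ vanishes at no $\mathbf{x}\in\mathbb{R}^n\setminus\{0\}$. Assume that $k\ge\frac{\deg V+1}{2}$, and that $\sigma^*\in R_{2k}^*$ is such that $H_{\sigma^*}$ minimizes $\mathrm{trace}(P^tHP)$ over $H\in\mathcal{H}^k(\mathbf{i})$ and has rank $r\le k$. Then $H_{\sigma^*}\in\mathcal{E}^k_r(\mathbf{i})$. More precisely, there are $\omega_1,\dots,\omega_r>0$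 and pairwise distinct points $\zeta_1,\dots,\zeta_r\in\mathbb{R}^n$ such that $$\sigma^*=\sum_{j=1}^r\omega_j\,\mathbf{e}_{\zeta_j}\ \text{ on } R_{2k},\qquad\text{and}\qquad \langle\mathbf{i}\mid v\rangle=\sum_{j=1}^r\omega_j\,v(\zeta_j)\ \text{ for all } v\in V,$$ that is, an $r$-point cubature formula exact on $V$. -/

import Mathlib

noncomputable section

namespace HankelCubature

open MvPolynomial

/-- `R_d`: the real polynomials in `x_1, …, x_n` of degree at most `d`. -/
abbrev PolyLE (n d : ℕ) : Submodule ℝ (MvPolynomial (Fin n) ℝ) :=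
  restrictTotalDegree (Fin n) ℝ d

/-- The exponents of the monomials of degree at most `k`: the index set of the monomial
basis of `R_k`, of size `s_k`. -/
abbrev Expo (n k : ℕ) : Type := {α : Fin n →₀ ℕ // α.degree ≤ k}

instance expoFinite (n k : ℕ) : Finite (Expo n k) := by
  refine Set.Finite.subset (Set.finite_Iic
    (Finsupp.equivFunOnFinite.symm (fun _ : Fin n => k))) ?_
  intro α hα i
  exact (Finsupp.le_degree i α).trans hα

instance expoFintype (n k : ℕ) : Fintype (Expo n k) := Fintype.ofFinite _

theorem monomial_mem {n d : ℕ} {α : Fin n →₀ ℕ} (h : α.degree ≤ d) :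
    monomial α (1 : ℝ) ∈ PolyLE n d := by
  rw [mem_restrictTotalDegree, totalDegree_monomial _ one_ne_zero]
  exact h

theorem mul_mem {n k : ℕ} (p q : PolyLE n k) :
    (p : MvPolynomial (Fin n) ℝ) * q ∈ PolyLE n (2 * k) := by
  have hp := (mem_restrictTotalDegree _ _ _).1 p.2
  have hq := (mem_restrictTotalDegree _ _ _).1 q.2
  rw [mem_restrictTotalDegree]
  have := totalDegree_mul (p : MvPolynomial (Fin n) ℝ) q
  omega

/-- The monomial `x^α`, as an element of `R_k`. -/
def mono {n k : ℕ} (α : Expo n k) : PolyLE n k := ⟨monomial α.1 1, monomial_mem α.2⟩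

/-- The truncated Hankel operator `H_σ : R_k → R_k^*`, `p ↦ (q ↦ ⟨σ | p q⟩)`, of a linear
form `σ` on `R_{2k}`. -/
def hankel {n k : ℕ} (σ : Module.Dual ℝ (PolyLE n (2 * k))) :
    PolyLE n k →ₗ[ℝ] Module.Dual ℝ (PolyLE n k) :=
  LinearMap.mk₂ ℝ (fun p q => σ ⟨(p : MvPolynomial (Fin n) ℝ) * q, mul_mem p q⟩)
    (fun p p' q => by
      rw [← map_add]; congr 1; ext1; simp [add_mul])
    (fun c p q => by
      rw [← map_smul]; congr 1; ext1; simp)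
    (fun p q q' => by
      rw [← map_add]; congr 1; ext1; simp [mul_add])
    (fun c p q => by
      rw [← map_smul]; congr 1; ext1; simp)

/-- Positive semidefiniteness of the quadratic form `p ↦ H(p, p)`
(a Hankel operator is symmetric by construction). -/
def IsPSD {n k : ℕ} (H : PolyLE n k →ₗ[ℝ] Module.Dual ℝ (PolyLE n k)) : Prop :=
  ∀ p, 0 ≤ H p p

/-- The matrix of `H` in the monomial basis of `R_k`; for `H = H_σ` its entries are
`⟨σ | x^(α+β)⟩`. -/
def toMat {n k : ℕ} (H : PolyLE n k →ₗ[ℝ] Module.Dual ℝ (PolyLE n k)) :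
    Matrix (Expo n k) (Expo n k) ℝ :=
  Matrix.of fun α β => H (mono α) (mono β)

/-- The space `V` spanned by the monomials `x^α`, `α ∈ A`. -/
abbrev monSpan {n : ℕ} (A : Finset (Fin n →₀ ℕ)) : Submodule ℝ (MvPolynomial (Fin n) ℝ) :=
  Submodule.span ℝ ((fun α => monomial α (1 : ℝ)) '' (A : Set (Fin n →₀ ℕ)))

/-- The monomial `x^α`, `α ∈ A`, as an element of `V`. -/
def monV {n : ℕ} {A : Finset (Fin n →₀ ℕ)} {α : Fin n →₀ ℕ} (h : α ∈ A) : monSpan A :=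
  ⟨monomial α 1, Submodule.subset_span ⟨α, h, rfl⟩⟩

/-- `deg V`, the largest degree of an element of `V`. -/
def degV {n : ℕ} (A : Finset (Fin n →₀ ℕ)) : ℕ := A.sup fun α => α.degree

/-- `σ` extends the moments of `i`: `σ_α = i_α` for the `α ∈ A`. (The degree condition only
says that `σ_α` makes sense; it holds for all `α ∈ A` as soon as `deg V ≤ d`.) -/
def ExtendsMoments {n d : ℕ} {A : Finset (Fin n →₀ ℕ)} (i : Module.Dual ℝ (monSpan A))
    (σ : Module.Dual ℝ (PolyLE n d)) : Prop :=
  ∀ (α : Fin n →₀ ℕ) (hA : α ∈ A) (hd : α.degree ≤ d),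
    σ ⟨monomial α 1, monomial_mem hd⟩ = i (monV hA)

/-- The set `ℋ^k(i)` of positive semidefinite truncated Hankel operators of the linear forms
on `R_{2k}` that extend the moments of `i`. -/
def hankelSet {n : ℕ} {A : Finset (Fin n →₀ ℕ)} (i : Module.Dual ℝ (monSpan A)) (k : ℕ) :
    Set (PolyLE n k →ₗ[ℝ] Module.Dual ℝ (PolyLE n k)) :=
  {H | ∃ σ : Module.Dual ℝ (PolyLE n (2 * k)),
    H = hankel σ ∧ ExtendsMoments i σ ∧ IsPSD (hankel σ)}

/-- Evaluation `e_ζ` at `ζ ∈ ℝⁿ`, on polynomials of degree at most `d`. -/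
def evalAt {n : ℕ} (d : ℕ) (ζ : Fin n → ℝ) : Module.Dual ℝ (PolyLE n d) :=
  (aeval ζ : MvPolynomial (Fin n) ℝ →ₐ[ℝ] ℝ).toLinearMap.domRestrict (PolyLE n d)

/-- The set `ℰ^k_r(i)` of the elements `H_σ` of `ℋ^k(i)` with `σ = ∑_{j ≤ r} ω_j e_{ζ_j}`,
`ω_j > 0`, `ζ_j ∈ ℝⁿ`. -/
def cubatureSet {n : ℕ} {A : Finset (Fin n →₀ ℕ)} (i : Module.Dual ℝ (monSpan A))
    (k r : ℕ) : Set (PolyLE n k →ₗ[ℝ] Module.Dual ℝ (PolyLE n k)) :=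
  {H | H ∈ hankelSet i k ∧ ∃ (ω : Fin r → ℝ) (ζ : Fin r → Fin n → ℝ),
    (∀ j, 0 < ω j) ∧ H = hankel (∑ j, ω j • evalAt (2 * k) (ζ j))}

/-- The objective `trace (Pᵗ H P)`. -/
def objective {n k : ℕ} (P : Matrix (Expo n k) (Expo n k) ℝ)
    (H : PolyLE n k →ₗ[ℝ] Module.Dual ℝ (PolyLE n k)) : ℝ :=
  (P.transpose * toMat H * P).trace

/-- `H` is a minimizer of `trace (Pᵗ H P)` over `ℋ^k(i)`. -/
def IsMinimizer {n k : ℕ} {A : Finset (Fin n →₀ ℕ)} (i : Module.Dual ℝ (monSpan A))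
    (P : Matrix (Expo n k) (Expo n k) ℝ)
    (H : PolyLE n k →ₗ[ℝ] Module.Dual ℝ (PolyLE n k)) : Prop :=
  H ∈ hankelSet i k ∧ ∀ H' ∈ hankelSet i k, objective P H ≤ objective P H'

/-- The polynomial `q(x) = (x^(k))ᵗ P Pᵗ x^(k)`, where `x^(k)` is the vector of the monomials
of degree at most `k`. -/
def quadPoly {n k : ℕ} (P : Matrix (Expo n k) (Expo n k) ℝ) : MvPolynomial (Fin n) ℝ :=
  ∑ α : Expo n k, ∑ β : Expo n k,
    C ((P * P.transpose) α β) * (monomial α.1 1 * monomial β.1 1)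

/-- `P` is proper: the component of degree `2k` of `q` has no zero other than the origin. -/
def IsProper {n k : ℕ} (P : Matrix (Expo n k) (Expo n k) ℝ) : Prop :=
  ∀ x : Fin n → ℝ, x ≠ 0 → eval x (homogeneousComponent (2 * k) (quadPoly P)) ≠ 0

end HankelCubature

end

/-!
Homogenize with an extra variable: `σ` becomes a linear form `Λ` on the forms of degree `2k`, and
`Λ (p * q) = ⟪φ p, φ q⟫` for a linear map `φ` of rank at most `k`. For a variable `X o`, let `W` be
the image under `φ` of `X o * S`, with `S` the forms of degree `k - 1`. The compression to `W` of
the multiplication by `X i / X o` is symmetric. These compressions commute: every element of `W`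
has a representative `X o * p` such that `φ (X i * p) ∈ W` for all `i`. Indeed, either every
element of `W` comes from a multiple of `X o ^ 2`, or the images under `φ` of the multiples of
`X o`, `X o ^ 2`, …, `X o ^ k`, `0` strictly decrease, and then the bound on the rank makes `W` the
whole image of `φ`. The joint eigenvalues are points `a` with `a o = 1`, and evaluation at these
points, with positive weights, gives the part of the Gram form carried by `W`. The rest vanishes on
the multiples of `X o`, so an induction over the variables represents `Λ` by points of projective
space.

A point at infinity does not see the moments of degree less than `2k`, and it strictly increases
the objective since `P` is proper; so a minimizer has none. At most `k + 1` points are separated by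
polynomials of degree `k`, whence their number is the rank.
-/

noncomputable section

namespace HankelCubature

open MvPolynomial

section DivisibleForms

variable {ι R : Type*} [CommSemiring R]

theorem isHomogeneous_X_mul_iff {i : ι} {p : MvPolynomial ι R} {d : ℕ} :
    (X i * p).IsHomogeneous (d + 1) ↔ p.IsHomogeneous d := by
  refine ⟨fun h m hm => ?_, fun h => add_comm d 1 ▸ (isHomogeneous_X R i).mul h⟩
  have hweight := @h (Finsupp.single i 1 + m) (by rwa [coeff_X_mul])
  simp only [map_add, Finsupp.weight_single, Pi.one_apply, smul_eq_mul, mul_one] at hweight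
  omega

theorem homogeneousSubmodule_mul_homogeneousSubmodule (a b : ℕ) :
    homogeneousSubmodule ι R a * homogeneousSubmodule ι R b = homogeneousSubmodule ι R (a + b) := by
  rw [← homogeneousSubmodule_one_pow R a, ← homogeneousSubmodule_one_pow R b, ← pow_add,
    homogeneousSubmodule_one_pow]

theorem homogeneousSubmodule_succ_le {d : ℕ} {N : Submodule R (MvPolynomial ι R)}
    (hN : ∀ i, ∀ p ∈ homogeneousSubmodule ι R d, X i * p ∈ N) :
    homogeneousSubmodule ι R (d + 1) ≤ N := by
  rw [add_comm, ← homogeneousSubmodule_mul_homogeneousSubmodule,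
    homogeneousSubmodule_one_eq_span_X, Submodule.mul_le]
  intro l hl p hp
  have hspan : Submodule.span R (Set.range X) ≤ N.comap (LinearMap.mulRight R p) :=
    Submodule.span_le.2 (Set.range_subset_iff.2 fun i => hN i p hp)
  exact hspan hl

/-- The forms of degree `d` divisible by `X o ^ e`: as `e` decreases, they filter the forms of
degree `d`. -/
def divisibleForms (R : Type*) [CommSemiring R] (o : ι) (d e : ℕ) :
    Submodule R (MvPolynomial ι R) :=
  homogeneousSubmodule ι R d ⊓ (Ideal.span {X o ^ e}).restrictScalars R

theorem mem_divisibleForms {o : ι} {d e : ℕ} {f : MvPolynomial ι R} :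
    f ∈ divisibleForms R o d e ↔ f.IsHomogeneous d ∧ X o ^ e ∣ f := by
  rw [divisibleForms, Submodule.mem_inf, mem_homogeneousSubmodule, Submodule.restrictScalars_mem,
    Ideal.mem_span_singleton]

theorem divisibleForms_zero (o : ι) (d : ℕ) :
    divisibleForms R o d 0 = homogeneousSubmodule ι R d := by
  ext f
  simp [mem_divisibleForms]

theorem divisibleForms_antitone (o : ι) (d : ℕ) : Antitone (divisibleForms R o d) :=
  fun _ _ h _ hf => mem_divisibleForms.2
    ((mem_divisibleForms.1 hf).imp_right (pow_dvd_pow _ h).trans)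

theorem X_mul_mem_divisibleForms {o : ι} {d e : ℕ} {p : MvPolynomial ι R} (i : ι)
    (hp : p ∈ divisibleForms R o d e) : X i * p ∈ divisibleForms R o (d + 1) e :=
  mem_divisibleForms.2
    ((mem_divisibleForms.1 hp).imp isHomogeneous_X_mul_iff.2 (Dvd.dvd.mul_left · _))

theorem divisibleForms_succ_succ (o : ι) (d e : ℕ) :
    divisibleForms R o (d + 1) (e + 1) =
      (divisibleForms R o d e).map (LinearMap.mulLeft R (X o)) := by
  ext f
  simp only [Submodule.mem_map, mem_divisibleForms, LinearMap.mulLeft_apply]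
  constructor
  · rintro ⟨hf, g, rfl⟩
    rw [pow_succ', mul_assoc] at hf ⊢
    exact ⟨X o ^ e * g, ⟨isHomogeneous_X_mul_iff.1 hf, dvd_mul_right _ _⟩, rfl⟩
  · rintro ⟨p, ⟨hp, hdvd⟩, rfl⟩
    exact ⟨isHomogeneous_X_mul_iff.2 hp, pow_succ' (X o : MvPolynomial ι R) e ▸
      mul_dvd_mul_left _ hdvd⟩

theorem divisibleForms_succ_one (o : ι) (d : ℕ) :
    divisibleForms R o (d + 1) 1 =
      (homogeneousSubmodule ι R d).map (LinearMap.mulLeft R (X o)) := by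
  rw [divisibleForms_succ_succ, divisibleForms_zero]

theorem divisibleForms_self (o : ι) (d : ℕ) :
    divisibleForms R o d d = Submodule.span R {X o ^ d} := by
  induction d with
  | zero => rw [divisibleForms_zero, homogeneousSubmodule_zero, pow_zero, Submodule.one_eq_span]
  | succ d ih =>
    rw [divisibleForms_succ_succ, ih, Submodule.map_span, Set.image_singleton,
      LinearMap.mulLeft_apply, pow_succ']

theorem divisibleForms_succ_le {o : ι} {d e : ℕ} (he : e ≤ d)
    {N : Submodule R (MvPolynomial ι R)}
    (hN : ∀ i, ∀ p ∈ divisibleForms R o d e, X i * p ∈ N) :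
    divisibleForms R o (d + 1) e ≤ N := by
  induction e generalizing d N with
  | zero =>
    rw [divisibleForms_zero] at hN ⊢
    exact homogeneousSubmodule_succ_le hN
  | succ e ih =>
    obtain ⟨d, rfl⟩ := Nat.exists_eq_add_of_le' (Nat.one_le_of_lt he)
    rw [divisibleForms_succ_succ, Submodule.map_le_iff_le_comap]
    refine ih (Nat.le_of_succ_le_succ he) fun i p hp => ?_
    rw [Submodule.mem_comap, LinearMap.mulLeft_apply, mul_left_comm]
    exact hN i _ (divisibleForms_succ_succ (R := R) o d e ▸ Submodule.mem_map_of_mem hp)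

end DivisibleForms

section GramMap

variable {ι E : Type*} [NormedAddCommGroup E] [InnerProductSpace ℝ E] {d : ℕ}
  {Λ : MvPolynomial ι ℝ →ₗ[ℝ] ℝ} {φ : MvPolynomial ι ℝ →ₗ[ℝ] E}

/-- On forms of degree `d`, the positive semidefinite form `(p, q) ↦ Λ (p * q)` is the Gram form
of `φ`. -/
def IsGramMap (d : ℕ) (Λ : MvPolynomial ι ℝ →ₗ[ℝ] ℝ) (φ : MvPolynomial ι ℝ →ₗ[ℝ] E) : Prop :=
  ∀ p q : MvPolynomial ι ℝ, p.IsHomogeneous d → q.IsHomogeneous d →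
    inner ℝ (φ p) (φ q) = Λ (p * q)

theorem IsGramMap.homogeneousSubmodule_le_ker (hφ : IsGramMap d Λ φ)
    (hker : homogeneousSubmodule ι ℝ d ≤ LinearMap.ker φ) :
    homogeneousSubmodule ι ℝ (d + d) ≤ LinearMap.ker Λ := by
  rw [← homogeneousSubmodule_mul_homogeneousSubmodule, Submodule.mul_le]
  intro p hp q hq
  rw [LinearMap.mem_ker, ← hφ p q hp hq, LinearMap.mem_ker.1 (hker hp), inner_zero_left]

theorem IsGramMap.inner_X_mul (hφ : IsGramMap (d + 1) Λ φ) (i l : ι) {p q : MvPolynomial ι ℝ}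
    (hp : p.IsHomogeneous d) (hq : q.IsHomogeneous d) :
    inner ℝ (φ (X i * p)) (φ (X l * q)) = inner ℝ (φ (X l * p)) (φ (X i * q)) := by
  rw [hφ _ _ (isHomogeneous_X_mul_iff.2 hp) (isHomogeneous_X_mul_iff.2 hq),
    hφ _ _ (isHomogeneous_X_mul_iff.2 hp) (isHomogeneous_X_mul_iff.2 hq)]
  congr 1
  ring

theorem IsGramMap.map_X_mul_X_mul_eq_zero (hφ : IsGramMap (d + 2) Λ φ) {o : ι}
    {p : MvPolynomial ι ℝ} (hp : p.IsHomogeneous d) (h : φ (X o * (X o * p)) = 0) (i : ι) :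
    φ (X i * (X o * p)) = 0 := by
  rw [← inner_self_eq_zero (𝕜 := ℝ)]
  nth_rewrite 2 [mul_left_comm]
  rw [hφ.inner_X_mul i o (isHomogeneous_X_mul_iff.2 hp) (isHomogeneous_X_mul_iff.2 hp), h,
    inner_zero_left]

theorem IsGramMap.map_divisibleForms_le (hφ : IsGramMap (d + 1) Λ φ) (o : ι) {e : ℕ}
    (he : e + 1 ≤ d)
    (h : (divisibleForms ℝ o (d + 1) (e + 2)).map φ ≤
      (divisibleForms ℝ o (d + 1) (e + 3)).map φ) :
    (divisibleForms ℝ o (d + 1) (e + 1)).map φ ≤ (divisibleForms ℝ o (d + 1) (e + 2)).map φ := by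
  obtain ⟨d, rfl⟩ := Nat.exists_eq_add_of_le' (Nat.one_le_of_lt he)
  rw [Submodule.map_le_iff_le_comap]
  refine divisibleForms_succ_le he fun i p hp => ?_
  obtain ⟨q, hq, rfl⟩ := divisibleForms_succ_succ (R := ℝ) o d e ▸ hp
  simp only [divisibleForms_succ_succ o (d + 1), divisibleForms_succ_succ o d] at h
  obtain ⟨_, ⟨_, ⟨q₁, hq₁, rfl⟩, rfl⟩, hqq₁⟩ :=
    h (Submodule.mem_map_of_mem (Submodule.mem_map_of_mem (Submodule.mem_map_of_mem hq)))
  simp only [LinearMap.mulLeft_apply] at hqq₁ ⊢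
  have hzero : φ (X i * (X o * (q - q₁))) = 0 := by
    refine hφ.map_X_mul_X_mul_eq_zero
      ((mem_divisibleForms.1 hq).1.sub (mem_divisibleForms.1 hq₁).1) ?_ i
    rw [mul_sub, mul_sub, map_sub, hqq₁, sub_self]
  rw [mul_sub, mul_sub, map_sub, sub_eq_zero] at hzero
  rw [Submodule.mem_comap, hzero]
  refine Submodule.mem_map_of_mem (X_mul_mem_divisibleForms i ?_)
  exact divisibleForms_succ_succ (R := ℝ) o d (e + 1) ▸ Submodule.mem_map_of_mem hq₁

/-- The image under `φ` of the forms `X o * p` with `p` a form of degree `d`: the space carrying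
the operators of multiplication by `X i / X o`. -/
def multiplesImage (φ : MvPolynomial ι ℝ →ₗ[ℝ] E) (o : ι) (d : ℕ) : Submodule ℝ E :=
  (homogeneousSubmodule ι ℝ d).map (φ ∘ₗ LinearMap.mulLeft ℝ (X o))

theorem map_divisibleForms_succ_one (φ : MvPolynomial ι ℝ →ₗ[ℝ] E) (o : ι) (d : ℕ) :
    (divisibleForms ℝ o (d + 1) 1).map φ = multiplesImage φ o d := by
  rw [divisibleForms_succ_one, multiplesImage, Submodule.map_comp]

theorem map_X_mul_mem_multiplesImage {o : ι} {p : MvPolynomial ι ℝ} (hp : p.IsHomogeneous d) :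
    φ (X o * p) ∈ multiplesImage φ o d :=
  ⟨p, hp, rfl⟩

variable [FiniteDimensional ℝ E]

theorem IsGramMap.lt_finrank_map_divisibleForms (hφ : IsGramMap (d + 1) Λ φ) (o : ι)
    (h : ¬ (divisibleForms ℝ o (d + 1) 1).map φ ≤ (divisibleForms ℝ o (d + 1) 2).map φ) :
    d < Module.finrank ℝ ((divisibleForms ℝ o (d + 1) 1).map φ) := by
  have hlt : ∀ e ≤ d, (divisibleForms ℝ o (d + 1) (e + 2)).map φ <
      (divisibleForms ℝ o (d + 1) (e + 1)).map φ := fun e he => by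
    refine lt_of_le_not_ge (Submodule.map_mono (divisibleForms_antitone o _ (by omega))) ?_
    induction e with
    | zero => exact h
    | succ e ih => exact fun hle => ih (by omega) (hφ.map_divisibleForms_le o he hle)
  have hcount : ∀ e ≤ d + 1, Module.finrank ℝ ((divisibleForms ℝ o (d + 1) (e + 1)).map φ) + e ≤
      Module.finrank ℝ ((divisibleForms ℝ o (d + 1) 1).map φ) := fun e he => by
    induction e with
    | zero => exact le_rfl
    | succ e ih =>
      have hdrop : Module.finrank ℝ ((divisibleForms ℝ o (d + 1) (e + 1 + 1)).map φ) < _ :=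
        Submodule.finrank_lt_finrank_of_lt (hlt e (by omega))
      have := ih (by omega)
      omega
  have := hcount (d + 1) le_rfl
  omega

theorem IsGramMap.exists_forall_map_X_mul_mem (hφ : IsGramMap (d + 1) Λ φ) (o : ι)
    (hrank : Module.finrank ℝ ((homogeneousSubmodule ι ℝ (d + 1)).map φ) ≤ d + 1)
    {w : E} (hw : w ∈ multiplesImage φ o d) :
    ∃ p : MvPolynomial ι ℝ, p.IsHomogeneous d ∧ φ (X o * p) = w ∧
      ∀ i, φ (X i * p) ∈ multiplesImage φ o d := by
  rw [← map_divisibleForms_succ_one] at hw ⊢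
  by_cases hstat : (divisibleForms ℝ o (d + 1) 1).map φ ≤ (divisibleForms ℝ o (d + 1) 2).map φ
  · obtain ⟨f, hf, rfl⟩ := hstat hw
    obtain ⟨p, hp, rfl⟩ := divisibleForms_succ_succ (R := ℝ) o d 1 ▸ hf
    exact ⟨p, (mem_divisibleForms.1 hp).1, rfl,
      fun i => Submodule.mem_map_of_mem (X_mul_mem_divisibleForms i hp)⟩
  · have hfull : (divisibleForms ℝ o (d + 1) 1).map φ =
        (homogeneousSubmodule ι ℝ (d + 1)).map φ :=
      Submodule.eq_of_le_of_finrank_le (Submodule.map_mono inf_le_left)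
        (hrank.trans (hφ.lt_finrank_map_divisibleForms o hstat))
    obtain ⟨f, hf, rfl⟩ := hw
    obtain ⟨p, hp, rfl⟩ := divisibleForms_succ_one (R := ℝ) o d ▸ hf
    exact ⟨p, hp, rfl,
      fun i => hfull ▸ Submodule.mem_map_of_mem (isHomogeneous_X_mul_iff.2 hp)⟩

theorem exists_section_multiplesImage (φ : MvPolynomial ι ℝ →ₗ[ℝ] E) (o : ι) (d : ℕ) :
    ∃ s : multiplesImage φ o d →ₗ[ℝ] homogeneousSubmodule ι ℝ d,
      ∀ w, φ (X o * (s w : MvPolynomial ι ℝ)) = w := by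
  obtain ⟨s, hs⟩ := ((φ ∘ₗ LinearMap.mulLeft ℝ (X o)).submoduleMap
    (homogeneousSubmodule ι ℝ d)).exists_rightInverse_of_surjective
      (LinearMap.range_eq_top.2 (LinearMap.submoduleMap_surjective _ _))
  exact ⟨s, fun w => congrArg Subtype.val (LinearMap.congr_fun hs w)⟩

/-- The compression to `multiplesImage φ o d` of the multiplication by `X i / X o`, that is, of the
correspondence `φ (X o * p) ↦ φ (X i * p)`. A linear section of `p ↦ φ (X o * p)` picks the
representatives; for a Gram map `φ` the choice does not matter. -/
def multiplicationOperator (φ : MvPolynomial ι ℝ →ₗ[ℝ] E) (o : ι) (d : ℕ) (i : ι) :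
    multiplesImage φ o d →ₗ[ℝ] multiplesImage φ o d :=
  (multiplesImage φ o d).orthogonalProjectionOnto.toLinearMap ∘ₗ φ ∘ₗ LinearMap.mulLeft ℝ (X i) ∘ₗ
    (homogeneousSubmodule ι ℝ d).subtype ∘ₗ (exists_section_multiplesImage φ o d).choose

theorem IsGramMap.multiplicationOperator_apply (hφ : IsGramMap (d + 1) Λ φ) (o i : ι)
    {p : MvPolynomial ι ℝ} (hp : p.IsHomogeneous d) :
    multiplicationOperator φ o d i ⟨φ (X o * p), map_X_mul_mem_multiplesImage hp⟩ =
      (multiplesImage φ o d).orthogonalProjectionOnto (φ (X i * p)) := by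
  let p' := (exists_section_multiplesImage φ o d).choose
    ⟨φ (X o * p), map_X_mul_mem_multiplesImage hp⟩
  have hp' : φ (X o * (p' : MvPolynomial ι ℝ)) = φ (X o * p) :=
    (exists_section_multiplesImage φ o d).choose_spec _
  change (multiplesImage φ o d).orthogonalProjectionOnto (φ (X i * (p' : MvPolynomial ι ℝ))) = _
  refine ext_inner_right ℝ fun v => ?_
  obtain ⟨q, hq, hv⟩ := v.2
  rw [LinearMap.comp_apply, LinearMap.mulLeft_apply] at hv
  rw [Submodule.inner_orthogonalProjectionOnto_eq_of_mem_right,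
    Submodule.inner_orthogonalProjectionOnto_eq_of_mem_right, ← hv,
    hφ.inner_X_mul i o p'.2 hq, hφ.inner_X_mul i o hp hq, hp']

theorem IsGramMap.inner_multiplicationOperator (hφ : IsGramMap (d + 1) Λ φ) (o i : ι)
    {p q : MvPolynomial ι ℝ} (hp : p.IsHomogeneous d) (hq : q.IsHomogeneous d) :
    inner ℝ (multiplicationOperator φ o d i ⟨φ (X o * p), map_X_mul_mem_multiplesImage hp⟩)
      (⟨φ (X o * q), map_X_mul_mem_multiplesImage hq⟩ : multiplesImage φ o d) =
      inner ℝ (φ (X i * p)) (φ (X o * q)) := by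
  rw [hφ.multiplicationOperator_apply o i hp,
    Submodule.inner_orthogonalProjectionOnto_eq_of_mem_right]

theorem IsGramMap.isSymmetric_multiplicationOperator (hφ : IsGramMap (d + 1) Λ φ) (o i : ι) :
    (multiplicationOperator φ o d i).IsSymmetric := by
  rintro ⟨_, p, hp, rfl⟩ ⟨_, q, hq, rfl⟩
  refine (hφ.inner_multiplicationOperator o i hp hq).trans ?_
  rw [hφ.inner_X_mul i o hp hq, real_inner_comm, ← hφ.inner_multiplicationOperator o i hq hp,
    real_inner_comm]
  rfl

theorem IsGramMap.commute_multiplicationOperator (hφ : IsGramMap (d + 1) Λ φ) (o : ι)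
    (hrank : Module.finrank ℝ ((homogeneousSubmodule ι ℝ (d + 1)).map φ) ≤ d + 1) (i j : ι) :
    Commute (multiplicationOperator φ o d i) (multiplicationOperator φ o d j) := by
  refine LinearMap.ext fun u => ext_inner_right ℝ ?_
  rintro ⟨_, q, hq, rfl⟩
  obtain ⟨p, hp, hu, hmem⟩ := hφ.exists_forall_map_X_mul_mem o hrank u.2
  obtain rfl : (⟨φ (X o * p), map_X_mul_mem_multiplesImage hp⟩ : multiplesImage φ o d) = u :=
    Subtype.ext hu
  have hinner (i j : ι) : inner ℝ (multiplicationOperator φ o d i (multiplicationOperator φ o d j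
      ⟨φ (X o * p), map_X_mul_mem_multiplesImage hp⟩))
      (⟨φ (X o * q), map_X_mul_mem_multiplesImage hq⟩ : multiplesImage φ o d) =
      inner ℝ (φ (X j * p)) (φ (X i * q)) := by
    rw [hφ.isSymmetric_multiplicationOperator, hφ.multiplicationOperator_apply o j hp,
      hφ.multiplicationOperator_apply o i hq,
      Submodule.inner_orthogonalProjectionOnto_eq_of_mem_left,
      Submodule.coe_orthogonalProjectionOnto_apply, Submodule.starProjection_eq_self_iff.2 (hmem j)]
  exact (hinner i j).trans ((hφ.inner_X_mul j i hp hq).trans (hinner j i).symm)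

theorem exists_orthogonal_joint_eigenvectors {F : Type*} [NormedAddCommGroup F]
    [InnerProductSpace ℝ F] [FiniteDimensional ℝ F] {M : ι → F →ₗ[ℝ] F}
    (hM : ∀ i, (M i).IsSymmetric) (hcomm : ∀ i j, Commute (M i) (M j)) (v : F) :
    ∃ f : (ι → ℝ) →₀ F, (∀ a i, M i (f a) = a i • f a) ∧
      (Pairwise fun a b => inner ℝ (f a) (f b) = 0) ∧ f.sum (fun _ w => w) = v := by
  have hv : v ∈ ⨆ a : ι → ℝ, ⨅ i, Module.End.eigenspace (M i) (a i) := by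
    rw [LinearMap.IsSymmetric.iSup_iInf_eq_top_of_commute hM fun i j _ => hcomm i j]
    exact Submodule.mem_top
  obtain ⟨f, hf, hsum⟩ := (Submodule.mem_iSup_iff_exists_finsupp _ _).1 hv
  exact ⟨f, fun a i => Module.End.mem_eigenspace_iff.1 ((Submodule.mem_iInf _).1 (hf a) i),
    fun a b hab => LinearMap.IsSymmetric.orthogonalFamily_iInf_eigenspaces hM hab
      ⟨f a, hf a⟩ ⟨f b, hf b⟩, hsum⟩

/-- The vector-valued atomic functional `p ↦ ∑ a, p(a) • f a`. -/
def evalSum {F : Type*} [AddCommGroup F] [Module ℝ F] (f : (ι → ℝ) →₀ F) :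
    MvPolynomial ι ℝ →ₗ[ℝ] F :=
  f.sum fun a v => (aeval a).toLinearMap.smulRight v

theorem evalSum_apply {F : Type*} [AddCommGroup F] [Module ℝ F] (f : (ι → ℝ) →₀ F)
    (p : MvPolynomial ι ℝ) : evalSum f p = ∑ a ∈ f.support, aeval a p • f a := by
  simp [evalSum, Finsupp.sum, LinearMap.sum_apply]

theorem inner_evalSum {F : Type*} [NormedAddCommGroup F] [InnerProductSpace ℝ F]
    {f : (ι → ℝ) →₀ F} (hf : Pairwise fun a b => inner ℝ (f a) (f b) = 0)
    (p q : MvPolynomial ι ℝ) :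
    inner ℝ (evalSum f p) (evalSum f q) = ∑ a ∈ f.support, ‖f a‖ ^ 2 * aeval a (p * q) := by
  simp only [evalSum_apply, sum_inner, inner_sum, real_inner_smul_left, real_inner_smul_right]
  refine Finset.sum_congr rfl fun a ha => ?_
  rw [Finset.sum_eq_single_of_mem a ha fun b _ hb => by rw [hf hb, mul_zero, mul_zero],
    real_inner_self_eq_norm_sq, map_mul]
  ring

theorem IsGramMap.multiplicationOperator_self (hφ : IsGramMap (d + 1) Λ φ) (o : ι)
    (w : multiplesImage φ o d) : multiplicationOperator φ o d o w = w := by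
  obtain ⟨_, p, hp, rfl⟩ := w
  exact (hφ.multiplicationOperator_apply o o hp).trans
    (Submodule.orthogonalProjectionOnto_mem_subspace_eq_self ⟨_, map_X_mul_mem_multiplesImage hp⟩)

theorem IsGramMap.multiplicationOperator_orthogonalProjectionOnto (hφ : IsGramMap (d + 1) Λ φ)
    (o i : ι) {p : MvPolynomial ι ℝ} (hp : p.IsHomogeneous d) :
    multiplicationOperator φ o d i
        ((multiplesImage φ o d).orthogonalProjectionOnto (φ (X o * p))) =
      (multiplesImage φ o d).orthogonalProjectionOnto (φ (X i * p)) := by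
  rw [← hφ.multiplicationOperator_apply o i hp,
    ← Submodule.orthogonalProjectionOnto_mem_subspace_eq_self
      (⟨φ (X o * p), map_X_mul_mem_multiplesImage hp⟩ : multiplesImage φ o d)]

theorem IsGramMap.orthogonalProjectionOnto_eq_evalSum (hφ : IsGramMap (d + 1) Λ φ) {o : ι}
    {f : (ι → ℝ) →₀ multiplesImage φ o d}
    (heigen : ∀ a i, multiplicationOperator φ o d i (f a) = a i • f a)
    (hpow : (multiplesImage φ o d).orthogonalProjectionOnto (φ (X o ^ (d + 1))) =
      evalSum f (X o ^ (d + 1)))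
    {p : MvPolynomial ι ℝ} (hp : p.IsHomogeneous (d + 1)) :
    (multiplesImage φ o d).orthogonalProjectionOnto (φ p) = evalSum f p := by
  let M := multiplicationOperator φ o d
  have hM_evalSum (i p) : M i (evalSum f p) = evalSum f (X i * p) := by
    simp only [evalSum_apply, map_sum, map_smul, M, heigen, map_mul, aeval_X, mul_smul]
    exact Finset.sum_congr rfl fun a _ => smul_comm _ _ _
  suffices hle : ∀ e ≤ d + 1, divisibleForms ℝ o (d + 1) e ≤ LinearMap.eqLocus
      ((multiplesImage φ o d).orthogonalProjectionOnto.toLinearMap ∘ₗ φ) (evalSum f) from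
    hle 0 (Nat.zero_le _) (divisibleForms_zero (R := ℝ) o (d + 1) ▸ hp)
  intro e he
  induction he using Nat.decreasingInduction with
  | self => rwa [divisibleForms_self, Submodule.span_singleton_le_iff_mem]
  | of_succ e he ih =>
    refine divisibleForms_succ_le (Nat.lt_succ_iff.1 he) fun i p hp => ?_
    have hXp : X o * p ∈ divisibleForms ℝ o (d + 1) (e + 1) :=
      divisibleForms_succ_succ (R := ℝ) o d e ▸ Submodule.mem_map_of_mem hp
    calc (multiplesImage φ o d).orthogonalProjectionOnto (φ (X i * p))
      _ = M i ((multiplesImage φ o d).orthogonalProjectionOnto (φ (X o * p))) :=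
        (hφ.multiplicationOperator_orthogonalProjectionOnto o i (mem_divisibleForms.1 hp).1).symm
      _ = M i (evalSum f (X o * p)) := congrArg (M i) (ih hXp)
      _ = evalSum f (X o * (X i * p)) := by rw [hM_evalSum, mul_left_comm]
      _ = evalSum f (X i * p) := by rw [← hM_evalSum, hφ.multiplicationOperator_self]

theorem IsGramMap.exists_orthogonalProjectionOnto_eq_evalSum (hφ : IsGramMap (d + 1) Λ φ) (o : ι)
    (hrank : Module.finrank ℝ ((homogeneousSubmodule ι ℝ (d + 1)).map φ) ≤ d + 1) :
    ∃ f : (ι → ℝ) →₀ multiplesImage φ o d, (∀ a ∈ f.support, a o = 1) ∧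
      (Pairwise fun a b => inner ℝ (f a) (f b) = 0) ∧
      ∀ p : MvPolynomial ι ℝ, p.IsHomogeneous (d + 1) →
        (multiplesImage φ o d).orthogonalProjectionOnto (φ p) = evalSum f p := by
  let v : multiplesImage φ o d :=
    ⟨φ (X o * X o ^ d), map_X_mul_mem_multiplesImage (isHomogeneous_X_pow o d)⟩
  obtain ⟨f, heigen, horth, hsum⟩ := exists_orthogonal_joint_eigenvectors
    (hφ.isSymmetric_multiplicationOperator o) (hφ.commute_multiplicationOperator o hrank) v
  have hone : ∀ a ∈ f.support, a o = 1 := by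
    intro a ha
    have hfix := heigen a o
    rw [hφ.multiplicationOperator_self] at hfix
    exact smul_left_injective ℝ (Finsupp.mem_support_iff.1 ha)
      (hfix.symm.trans (one_smul ℝ _).symm)
  refine ⟨f, hone, horth, fun p hp => hφ.orthogonalProjectionOnto_eq_evalSum heigen ?_ hp⟩
  calc (multiplesImage φ o d).orthogonalProjectionOnto (φ (X o ^ (d + 1)))
    _ = v := pow_succ' (X o : MvPolynomial ι ℝ) d ▸
      Submodule.orthogonalProjectionOnto_mem_subspace_eq_self v
    _ = ∑ a ∈ f.support, f a := hsum.symm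
    _ = evalSum f (X o ^ (d + 1)) := by
      rw [evalSum_apply]
      exact Finset.sum_congr rfl fun a ha => by
        rw [map_pow, aeval_X, hone a ha, one_pow, one_smul]

theorem inner_starProjection_orthogonal (F : Submodule ℝ E) (x y : E) :
    inner ℝ (Fᗮ.starProjection x) (Fᗮ.starProjection y) = inner ℝ x y -
      inner ℝ (F.orthogonalProjectionOnto x) (F.orthogonalProjectionOnto y) := by
  rw [Submodule.inner_orthogonalProjectionOnto_eq_of_mem_left,
    Submodule.coe_orthogonalProjectionOnto_apply, Submodule.inner_starProjection_left_eq_right,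
    Submodule.starProjection_eq_self_iff.2 (Submodule.starProjection_apply_mem _ y),
    Submodule.starProjection_orthogonal_val, inner_sub_right,
    Submodule.inner_starProjection_left_eq_right]

theorem IsGramMap.exists_residual (hφ : IsGramMap (d + 1) Λ φ) (o : ι)
    (hrank : Module.finrank ℝ ((homogeneousSubmodule ι ℝ (d + 1)).map φ) ≤ d + 1) :
    ∃ μ ∈ PointedCone.hull ℝ ((fun a : ι → ℝ => (aeval a).toLinearMap) '' {0}ᶜ),
      IsGramMap (d + 1) (Λ - μ) ((multiplesImage φ o d)ᗮ.starProjection.toLinearMap ∘ₗ φ) := by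
  obtain ⟨f, hone, horth, hproj⟩ := hφ.exists_orthogonalProjectionOnto_eq_evalSum o hrank
  refine ⟨∑ a ∈ f.support, ‖f a‖ ^ 2 • (aeval a).toLinearMap, ?_, fun p q hp hq => ?_⟩
  · refine Submodule.sum_mem _ fun a ha =>
      PointedCone.smul_mem _ (sq_nonneg _) (PointedCone.subset_hull ⟨a, ?_, rfl⟩)
    rintro rfl
    exact zero_ne_one (hone 0 ha)
  · simp only [LinearMap.comp_apply, ContinuousLinearMap.coe_coe, inner_starProjection_orthogonal,
      hφ p q hp hq, hproj p hp, hproj q hq, inner_evalSum horth, LinearMap.sub_apply,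
      LinearMap.sum_apply, LinearMap.smul_apply, AlgHom.toLinearMap_apply, smul_eq_mul]

theorem IsGramMap.exists_mem_hull_of_forall_notMem (T : Finset ι) (hφ : IsGramMap (d + 1) Λ φ)
    (hrank : Module.finrank ℝ ((homogeneousSubmodule ι ℝ (d + 1)).map φ) ≤ d + 1)
    (hT : ∀ i ∉ T, ∀ p : MvPolynomial ι ℝ, p.IsHomogeneous d → φ (X i * p) = 0) :
    ∃ μ ∈ PointedCone.hull ℝ ((fun a : ι → ℝ => (aeval a).toLinearMap) '' {0}ᶜ),
      homogeneousSubmodule ι ℝ (d + 1 + (d + 1)) ≤ LinearMap.eqLocus Λ μ := by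
  classical
  induction T using Finset.induction_on generalizing φ Λ with
  | empty =>
    have hker : homogeneousSubmodule ι ℝ (d + 1) ≤ LinearMap.ker φ :=
      homogeneousSubmodule_succ_le fun i p hp => hT i (Finset.notMem_empty i) p hp
    exact ⟨0, Submodule.zero_mem _, hφ.homogeneousSubmodule_le_ker hker⟩
  | insert o T ho ih =>
    obtain ⟨μ, hμ, hres⟩ := hφ.exists_residual o hrank
    set ψ := (multiplesImage φ o d)ᗮ.starProjection.toLinearMap ∘ₗ φ with hψ
    have hrank_ψ : Module.finrank ℝ ((homogeneousSubmodule ι ℝ (d + 1)).map ψ) ≤ d + 1 := by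
      rw [hψ, Submodule.map_comp]
      exact (Submodule.finrank_map_le _ _).trans hrank
    have hT_ψ : ∀ i ∉ T, ∀ p : MvPolynomial ι ℝ, p.IsHomogeneous d → ψ (X i * p) = 0 := by
      intro i hi p hp
      obtain rfl | hio := eq_or_ne i o
      · exact Submodule.starProjection_orthogonal_apply_eq_zero (map_X_mul_mem_multiplesImage hp)
      · rw [hψ, LinearMap.comp_apply, hT i (by simp [hi, hio]) p hp, map_zero]
    obtain ⟨ν, hν, hΛ⟩ := ih hres hrank_ψ hT_ψ
    exact ⟨μ + ν, Submodule.add_mem _ hμ hν, fun f hf => sub_eq_iff_eq_add'.1 (hΛ hf)⟩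

theorem IsGramMap.exists_mem_hull [Finite ι] (hφ : IsGramMap d Λ φ)
    (hrank : Module.finrank ℝ ((homogeneousSubmodule ι ℝ d).map φ) ≤ d) :
    ∃ μ ∈ PointedCone.hull ℝ ((fun a : ι → ℝ => (aeval a).toLinearMap) '' {0}ᶜ),
      homogeneousSubmodule ι ℝ (d + d) ≤ LinearMap.eqLocus Λ μ := by
  obtain _ | d := d
  · have hker : homogeneousSubmodule ι ℝ 0 ≤ LinearMap.ker φ := by
      rw [LinearMap.le_ker_iff_map, ← Submodule.finrank_eq_zero (R := ℝ)]
      exact Nat.le_zero.1 hrank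
    exact ⟨0, Submodule.zero_mem _, hφ.homogeneousSubmodule_le_ker hker⟩
  · have := Fintype.ofFinite ι
    exact hφ.exists_mem_hull_of_forall_notMem Finset.univ hrank
      fun i hi => absurd (Finset.mem_univ i) hi

end GramMap

section GramSpace

theorem exists_gram_map.{u} {V : Type u} [AddCommGroup V] [Module ℝ V] (B : V →ₗ[ℝ] Module.Dual ℝ V)
    (hsymm : ∀ x y, B x y = B y x) (hpos : ∀ x, 0 ≤ B x x) :
    ∃ (E : Type u) (_ : NormedAddCommGroup E) (_ : InnerProductSpace ℝ E) (φ : V →ₗ[ℝ] E),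
      Function.Surjective φ ∧ ∀ x y, inner ℝ (φ x) (φ y) = B x y := by
  let core : PreInnerProductSpace.Core ℝ V :=
    { inner x y := B x y
      conj_inner_symm x y := hsymm y x
      re_inner_nonneg := hpos
      add_left x y z := by rw [map_add, LinearMap.add_apply]
      smul_left x y c := by rw [map_smul, LinearMap.smul_apply, smul_eq_mul, conj_trivial] }
  let : SeminormedAddCommGroup V := InnerProductSpace.Core.toSeminormedAddCommGroup (c := core)
  let : InnerProductSpace ℝ V := InnerProductSpace.ofCore core
  exact ⟨SeparationQuotient V, inferInstance, inferInstance,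
    (SeparationQuotient.mkCLM ℝ V : V →ₗ[ℝ] _), SeparationQuotient.surjective_mk, fun _ _ => rfl⟩

variable {V E : Type*} [AddCommGroup V] [Module ℝ V] [NormedAddCommGroup E]
  [InnerProductSpace ℝ E] {B : V →ₗ[ℝ] Module.Dual ℝ V} {φ : V →ₗ[ℝ] E}

theorem ker_eq_ker_of_inner_eq (h : ∀ x y, inner ℝ (φ x) (φ y) = B x y) :
    LinearMap.ker φ = LinearMap.ker B := by
  ext x
  refine ⟨fun hx => LinearMap.ext fun y => ?_, fun hx => ?_⟩
  · rw [← h, hx, inner_zero_left, LinearMap.zero_apply]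
  · rw [LinearMap.mem_ker, ← inner_self_eq_zero (𝕜 := ℝ), h, hx, LinearMap.zero_apply]

theorem finrank_range_eq_of_inner_eq (h : ∀ x y, inner ℝ (φ x) (φ y) = B x y) :
    Module.finrank ℝ (LinearMap.range φ) = Module.finrank ℝ (LinearMap.range B) :=
  (φ.quotKerEquivRange.symm ≪≫ₗ Submodule.quotEquivOfEq _ _ (ker_eq_ker_of_inner_eq h) ≪≫ₗ
    B.quotKerEquivRange).finrank_eq

end GramSpace

section Homogenization

variable {ι R : Type*} [CommSemiring R] {d : ℕ}

/-- Dehomogenization: the specialization of the variable `none` to `1`. -/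
def dehomogenize : MvPolynomial (Option ι) R →ₐ[R] MvPolynomial ι R :=
  aeval fun o => o.elim 1 X

theorem map_dehomogenize_le : (homogeneousSubmodule (Option ι) R d).map dehomogenize.toLinearMap ≤
    restrictTotalDegree ι R d := by
  rw [Submodule.map_le_iff_le_comap]
  induction d with
  | zero =>
    rw [homogeneousSubmodule_zero, Submodule.one_le, Submodule.mem_comap,
      AlgHom.toLinearMap_apply, map_one, mem_restrictTotalDegree, totalDegree_one]
  | succ d ih =>
    refine homogeneousSubmodule_succ_le fun o p hp => ?_
    have hX : (dehomogenize (X o : MvPolynomial (Option ι) R)).totalDegree ≤ 1 := by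
      rw [dehomogenize, aeval_X]
      cases o with
      | none => exact totalDegree_one.trans_le zero_le_one
      | some i => exact (isHomogeneous_X R i).totalDegree_le
    have hdeg := (mem_restrictTotalDegree _ _ _).1 (ih hp)
    rw [Submodule.mem_comap, AlgHom.toLinearMap_apply, map_mul, mem_restrictTotalDegree,
      add_comm d]
    exact (totalDegree_mul _ _).trans (add_le_add hX hdeg)

theorem dehomogenize_mem {p : MvPolynomial (Option ι) R} (hp : p.IsHomogeneous d) :
    dehomogenize p ∈ restrictTotalDegree ι R d :=
  map_dehomogenize_le (Submodule.mem_map_of_mem hp)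

theorem sum_range_homogeneousComponent {f : MvPolynomial ι R}
    (hf : f ∈ restrictTotalDegree ι R d) :
    ∑ j ∈ Finset.range (d + 1), homogeneousComponent j f = f := by
  rw [mem_restrictTotalDegree] at hf
  conv_rhs => rw [← sum_homogeneousComponent f]
  refine (Finset.sum_subset (Finset.range_mono (by omega)) fun j _ hj => ?_).symm
  exact homogeneousComponent_eq_zero _ _ (by simpa using hj)

/-- The homogenization in degree `d` with respect to the variable `none`. It is defined on all
polynomials, so as to be linear, and discards the components of degree above `d`. -/
def homogenize (d : ℕ) : MvPolynomial ι R →ₗ[R] MvPolynomial (Option ι) R :=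
  ∑ j ∈ Finset.range (d + 1), LinearMap.mulLeft R (X none ^ (d - j)) ∘ₗ
    (rename some).toLinearMap ∘ₗ homogeneousComponent j

theorem homogenize_apply (f : MvPolynomial ι R) : homogenize d f =
    ∑ j ∈ Finset.range (d + 1), X none ^ (d - j) * rename some (homogeneousComponent j f) := by
  simp [homogenize]

theorem isHomogeneous_homogenize (f : MvPolynomial ι R) : (homogenize d f).IsHomogeneous d := by
  rw [homogenize_apply]
  refine IsHomogeneous.sum _ _ _ fun j hj => ?_
  have hterm := (isHomogeneous_X_pow (R := R) (none : Option ι) (d - j)).mul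
    ((homogeneousComponent_isHomogeneous j f).rename_isHomogeneous (f := some))
  rwa [Nat.sub_add_cancel (Finset.mem_range_succ_iff.1 hj)] at hterm

theorem dehomogenize_homogenize {f : MvPolynomial ι R} (hf : f ∈ restrictTotalDegree ι R d) :
    dehomogenize (homogenize d f) = f := by
  have hrename : ∀ g : MvPolynomial ι R, dehomogenize (rename some g) = g := fun g => by
    rw [dehomogenize, aeval_rename]
    exact aeval_X_left_apply g
  have hnone : dehomogenize (X none : MvPolynomial (Option ι) R) = 1 := by
    rw [dehomogenize, aeval_X, Option.elim_none]
  simp only [homogenize_apply, map_sum, map_mul, map_pow, hnone, hrename, one_pow, one_mul,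
    sum_range_homogeneousComponent hf]

theorem map_dehomogenize : (homogeneousSubmodule (Option ι) R d).map dehomogenize.toLinearMap =
    restrictTotalDegree ι R d :=
  map_dehomogenize_le.antisymm fun f hf =>
    ⟨homogenize d f, isHomogeneous_homogenize f, dehomogenize_homogenize hf⟩

theorem restrictTotalDegree_mul_restrictTotalDegree (a b : ℕ) :
    restrictTotalDegree ι R a * restrictTotalDegree ι R b = restrictTotalDegree ι R (a + b) := by
  rw [← map_dehomogenize, ← map_dehomogenize, ← Submodule.map_mul,
    homogeneousSubmodule_mul_homogeneousSubmodule, map_dehomogenize]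

theorem homogeneousComponent_add_mul {a b : ℕ} {f g : MvPolynomial ι R}
    (hf : f ∈ restrictTotalDegree ι R a) (hg : g ∈ restrictTotalDegree ι R b) :
    homogeneousComponent (a + b) (f * g) =
      homogeneousComponent a f * homogeneousComponent b g := by
  have hterm : ∀ x ∈ Finset.range (a + 1), ∀ y ∈ Finset.range (b + 1), x ≠ a ∨ y ≠ b →
      homogeneousComponent (a + b) (homogeneousComponent x f * homogeneousComponent y g) = 0 := by
    intro x hx y hy hxy
    rw [Finset.mem_range] at hx hy
    rw [homogeneousComponent_of_mem ((homogeneousComponent_isHomogeneous x f).mul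
      (homogeneousComponent_isHomogeneous y g)), if_neg (by omega)]
  conv_lhs => rw [← sum_range_homogeneousComponent hf, ← sum_range_homogeneousComponent hg,
    Finset.sum_mul_sum]
  simp only [map_sum]
  rw [Finset.sum_eq_single_of_mem a (Finset.self_mem_range_succ a)
      fun x hx hxa => Finset.sum_eq_zero fun y hy => hterm x hx y hy (Or.inl hxa),
    Finset.sum_eq_single_of_mem b (Finset.self_mem_range_succ b)
      fun y hy hyb => hterm a (Finset.self_mem_range_succ a) y hy (Or.inr hyb),
    homogeneousComponent_of_mem ((homogeneousComponent_isHomogeneous a f).mul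
      (homogeneousComponent_isHomogeneous b g)), if_pos rfl]

theorem eval_smul_of_isHomogeneous {f : MvPolynomial ι R} (hf : f.IsHomogeneous d) (t : R)
    (a : ι → R) : eval (t • a) f = t ^ d * eval a f := by
  rw [eval_eq, eval_eq, Finset.mul_sum]
  refine Finset.sum_congr rfl fun m hm => ?_
  have hdeg : m.degree = d := by
    rw [Finsupp.degree_eq_weight_one]
    exact hf (mem_support_iff.1 hm)
  simp only [Pi.smul_apply, smul_eq_mul, mul_pow, Finset.prod_mul_distrib,
    Finset.prod_pow_eq_pow_sum]
  rw [← Finsupp.degree_apply, hdeg]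
  ring

theorem eval_homogenize_of_none_eq_zero {a : Option ι → R} (ha : a none = 0)
    (f : MvPolynomial ι R) :
    eval a (homogenize d f) = eval (a ∘ some) (homogeneousComponent d f) := by
  simp only [homogenize_apply, map_sum, map_mul, map_pow, eval_X, eval_rename, ha]
  rw [Finset.sum_range_succ, Nat.sub_self, pow_zero, one_mul, Finset.sum_eq_zero, zero_add]
  intro j hj
  rw [zero_pow (Nat.sub_ne_zero_of_lt (Finset.mem_range.1 hj)), zero_mul]

theorem eval_homogenize_of_none_ne_zero {K : Type*} [Field K] {a : Option ι → K}
    (ha : a none ≠ 0) {f : MvPolynomial ι K} (hf : f ∈ restrictTotalDegree ι K d) :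
    eval a (homogenize d f) = a none ^ d * eval ((a none)⁻¹ • (a ∘ some)) f := by
  conv_rhs => rw [← sum_range_homogeneousComponent hf, map_sum, Finset.mul_sum]
  simp only [homogenize_apply, map_sum, map_mul, map_pow, eval_X, eval_rename]
  refine Finset.sum_congr rfl fun j hj => ?_
  rw [eval_smul_of_isHomogeneous (homogeneousComponent_isHomogeneous j f),
    pow_sub₀ _ ha (Finset.mem_range_succ_iff.1 hj), inv_pow, mul_assoc]

end Homogenization

section Infinity

variable {n k : ℕ}

theorem hankel_apply (σ : Module.Dual ℝ (PolyLE n (2 * k))) (p q : PolyLE n k) :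
    hankel σ p q = σ ⟨(p : MvPolynomial (Fin n) ℝ) * q, mul_mem p q⟩ :=
  rfl

theorem hankel_comm (σ : Module.Dual ℝ (PolyLE n (2 * k))) (p q : PolyLE n k) :
    hankel σ p q = hankel σ q p :=
  congrArg σ (Subtype.ext (mul_comm _ _))

theorem hankel_injective (n k : ℕ) :
    Function.Injective (hankel : Module.Dual ℝ (PolyLE n (2 * k)) → _) := by
  intro σ τ h
  obtain ⟨σ', rfl⟩ := LinearMap.exists_extend σ
  obtain ⟨τ', rfl⟩ := LinearMap.exists_extend τ
  suffices hle : PolyLE n (2 * k) ≤ LinearMap.eqLocus σ' τ' from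
    LinearMap.ext fun f => hle f.2
  rw [two_mul, PolyLE, ← restrictTotalDegree_mul_restrictTotalDegree, Submodule.mul_le]
  exact fun p hp q hq => LinearMap.congr_fun₂ h ⟨p, hp⟩ ⟨q, hq⟩

theorem evalAt_apply {d : ℕ} (z : Fin n → ℝ) (f : PolyLE n d) :
    evalAt d z f = eval z (f : MvPolynomial (Fin n) ℝ) :=
  congrArg (· (f : MvPolynomial (Fin n) ℝ)) (coe_aeval_eq_eval z)

/-- Evaluation at the point at infinity in the direction `η`, on polynomials of degree at most
`d`: the value at `η` of the component of degree `d`. -/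
def evalAtInfinity (d : ℕ) (η : Fin n → ℝ) : Module.Dual ℝ (PolyLE n d) :=
  ((aeval η).toLinearMap ∘ₗ homogeneousComponent d).domRestrict (PolyLE n d)

theorem evalAtInfinity_apply {d : ℕ} (η : Fin n → ℝ) (f : PolyLE n d) :
    evalAtInfinity d η f = eval η (homogeneousComponent d (f : MvPolynomial (Fin n) ℝ)) :=
  congrArg (· (homogeneousComponent d (f : MvPolynomial (Fin n) ℝ))) (coe_aeval_eq_eval η)

theorem aeval_comp_homogenize_mem (k : ℕ) {a : Option (Fin n) → ℝ} (ha : a ≠ 0) :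
    (aeval a).toLinearMap ∘ₗ (homogenize (2 * k)).domRestrict (PolyLE n (2 * k)) ∈
      PointedCone.hull ℝ (Set.range (evalAt (2 * k))) ⊔
        PointedCone.hull ℝ (evalAtInfinity (2 * k) '' {0}ᶜ) := by
  obtain hnone | hnone := eq_or_ne (a none) 0
  · have hdir : a ∘ some ≠ 0 := fun h => ha (funext fun o => o.casesOn hnone (congrFun h))
    have heq : (aeval a).toLinearMap ∘ₗ (homogenize (2 * k)).domRestrict (PolyLE n (2 * k)) =
        evalAtInfinity (2 * k) (a ∘ some) := LinearMap.ext fun f => by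
      rw [evalAtInfinity_apply, ← eval_homogenize_of_none_eq_zero hnone]
      simp [aeval_eq_eval]
    exact heq ▸ Submodule.mem_sup_right (PointedCone.subset_hull ⟨_, hdir, rfl⟩)
  · have heq : (aeval a).toLinearMap ∘ₗ (homogenize (2 * k)).domRestrict (PolyLE n (2 * k)) =
        a none ^ (2 * k) • evalAt (2 * k) ((a none)⁻¹ • (a ∘ some)) := LinearMap.ext fun f => by
      rw [LinearMap.smul_apply, smul_eq_mul, evalAt_apply,
        ← eval_homogenize_of_none_ne_zero hnone f.2]
      simp [aeval_eq_eval]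
    exact heq ▸ Submodule.mem_sup_left (PointedCone.smul_mem _
      (Even.pow_nonneg (even_two_mul k) _) (PointedCone.subset_hull ⟨_, rfl⟩))

theorem IsPSD.exists_isGramMap {σ' : MvPolynomial (Fin n) ℝ →ₗ[ℝ] ℝ}
    (hpsd : IsPSD (hankel (σ' ∘ₗ (PolyLE n (2 * k)).subtype))) :
    ∃ (E : Type) (_ : NormedAddCommGroup E) (_ : InnerProductSpace ℝ E)
      (_ : FiniteDimensional ℝ E) (φ : MvPolynomial (Option (Fin n)) ℝ →ₗ[ℝ] E),
      IsGramMap k (σ' ∘ₗ dehomogenize.toLinearMap) φ ∧ Module.finrank ℝ E =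
        Module.finrank ℝ (LinearMap.range (hankel (σ' ∘ₗ (PolyLE n (2 * k)).subtype))) := by
  obtain ⟨E, _, _, ψ, hsurj, hψ⟩ := exists_gram_map _ (hankel_comm _) hpsd
  obtain ⟨φ, rfl⟩ := LinearMap.exists_extend ψ
  refine ⟨E, inferInstance, inferInstance, Module.Finite.of_surjective _ hsurj,
    φ ∘ₗ dehomogenize.toLinearMap, fun p q hp hq => ?_, ?_⟩
  · rw [LinearMap.comp_apply (f := σ'), AlgHom.toLinearMap_apply, map_mul]
    exact hψ ⟨_, dehomogenize_mem hp⟩ ⟨_, dehomogenize_mem hq⟩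
  · rw [← finrank_range_eq_of_inner_eq hψ, LinearMap.range_eq_top.2 hsurj, finrank_top]

theorem IsPSD.mem_hull_evalAt_sup {σ : Module.Dual ℝ (PolyLE n (2 * k))} (hpsd : IsPSD (hankel σ))
    (hrank : Module.finrank ℝ (LinearMap.range (hankel σ)) ≤ k) :
    σ ∈ PointedCone.hull ℝ (Set.range (evalAt (2 * k))) ⊔
      PointedCone.hull ℝ (evalAtInfinity (2 * k) '' {0}ᶜ) := by
  obtain ⟨σ', rfl⟩ := LinearMap.exists_extend σ
  obtain ⟨E, _, _, _, φ, hφ, hE⟩ := hpsd.exists_isGramMap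
  obtain ⟨μ, hμ, hσμ⟩ := hφ.exists_mem_hull
    ((Submodule.finrank_le _).trans (hE.trans_le hrank))
  have hσ : σ' ∘ₗ (PolyLE n (2 * k)).subtype =
      μ ∘ₗ (homogenize (2 * k)).domRestrict (PolyLE n (2 * k)) := LinearMap.ext fun f => by
    rw [← two_mul] at hσμ
    have hf := hσμ (isHomogeneous_homogenize (f : MvPolynomial (Fin n) ℝ))
    rw [LinearMap.mem_eqLocus, LinearMap.comp_apply, AlgHom.toLinearMap_apply,
      dehomogenize_homogenize f.2] at hf
    exact hf
  have hle : PointedCone.hull ℝ ((fun a : Option (Fin n) → ℝ => (aeval a).toLinearMap) '' {0}ᶜ) ≤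
      PointedCone.comap (LinearMap.lcomp ℝ ℝ ((homogenize (2 * k)).domRestrict (PolyLE n (2 * k))))
        (PointedCone.hull ℝ (Set.range (evalAt (2 * k))) ⊔
          PointedCone.hull ℝ (evalAtInfinity (2 * k) '' {0}ᶜ)) :=
    Submodule.span_le.2 (Set.image_subset_iff.2 fun a ha => aeval_comp_homogenize_mem k ha)
  exact hσ ▸ hle hμ

end Infinity

section Minimizers

variable {n k : ℕ} {A : Finset (Fin n →₀ ℕ)} {i : Module.Dual ℝ (monSpan A)}

theorem hankel_mem_hankelSet_iff {σ : Module.Dual ℝ (PolyLE n (2 * k))} :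
    hankel σ ∈ hankelSet i k ↔ ExtendsMoments i σ ∧ IsPSD (hankel σ) := by
  refine ⟨?_, fun h => ⟨σ, rfl, h⟩⟩
  rintro ⟨σ', hσ', h⟩
  exact hankel_injective n k hσ' ▸ h

theorem degree_le_of_degV_le {d : ℕ} (h : degV A ≤ d) {α : Fin n →₀ ℕ} (hα : α ∈ A) :
    α.degree ≤ d :=
  (Finset.le_sup (f := fun α : Fin n →₀ ℕ => α.degree) hα).trans h

theorem monSpan_le {d : ℕ} (h : degV A ≤ d) : monSpan A ≤ PolyLE n d :=
  Submodule.span_le.2 (Set.image_subset_iff.2 fun _ hα =>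
    monomial_mem (degree_le_of_degV_le h hα))

theorem extendsMoments_iff {d : ℕ} (h : degV A ≤ d) {σ : Module.Dual ℝ (PolyLE n d)} :
    ExtendsMoments i σ ↔ σ ∘ₗ Submodule.inclusion (monSpan_le h) = i := by
  constructor
  · intro hσ
    refine LinearMap.ext_on Submodule.span_span_coe_preimage ?_
    rintro ⟨v, hv⟩ ⟨α, hα, rfl⟩
    exact hσ α hα (degree_le_of_degV_le h hα)
  · rintro rfl _ _ _
    rfl

theorem isPSD_hankel_of_mem_hull {S : Set (Module.Dual ℝ (PolyLE n (2 * k)))}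
    (hS : ∀ τ ∈ S, IsPSD (hankel τ)) {μ : Module.Dual ℝ (PolyLE n (2 * k))}
    (hμ : μ ∈ PointedCone.hull ℝ S) : IsPSD (hankel μ) := by
  intro p
  induction hμ using Submodule.span_induction with
  | mem τ hτ => exact hS τ hτ p
  | zero => exact le_rfl
  | add μ ν _ _ hμ hν => exact add_nonneg hμ hν
  | smul c μ _ hμ => exact mul_nonneg c.2 hμ

theorem isPSD_hankel_evalAt (ζ : Fin n → ℝ) : IsPSD (hankel (evalAt (2 * k) ζ)) := by
  intro p
  rw [hankel_apply, evalAt_apply, map_mul]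
  exact mul_self_nonneg _

theorem isPSD_hankel_evalAtInfinity (η : Fin n → ℝ) :
    IsPSD (hankel (evalAtInfinity (2 * k) η)) := by
  intro p
  rw [hankel_apply, evalAtInfinity_apply]
  simp only [two_mul, homogeneousComponent_add_mul p.2 p.2, map_mul]
  exact mul_self_nonneg _

theorem quadPoly_mem (P : Matrix (Expo n k) (Expo n k) ℝ) : quadPoly P ∈ PolyLE n (2 * k) := by
  refine Submodule.sum_mem _ fun α _ => Submodule.sum_mem _ fun β _ => ?_
  rw [C_mul']
  exact Submodule.smul_mem _ _ (mul_mem (mono α) (mono β))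

theorem objective_hankel (P : Matrix (Expo n k) (Expo n k) ℝ)
    (σ : Module.Dual ℝ (PolyLE n (2 * k))) :
    objective P (hankel σ) = σ ⟨quadPoly P, quadPoly_mem P⟩ := by
  have hquad : (⟨quadPoly P, quadPoly_mem P⟩ : PolyLE n (2 * k)) =
      ∑ α : Expo n k, ∑ β : Expo n k, (P * P.transpose) α β •
        ⟨(mono β : MvPolynomial (Fin n) ℝ) * mono α, mul_mem (mono β) (mono α)⟩ := by
    ext1
    simp only [quadPoly, mono, C_mul', Submodule.coe_sum, Submodule.coe_smul,
      mul_comm (monomial _ (1 : ℝ)) (monomial _ 1)]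
  rw [hquad, objective, Matrix.trace_mul_cycle]
  simp only [map_sum, map_smul, smul_eq_mul, Matrix.trace, Matrix.diag,
    Matrix.mul_apply (M := P * P.transpose), toMat, Matrix.of_apply, hankel_apply]

theorem objective_nonneg (P : Matrix (Expo n k) (Expo n k) ℝ)
    {H : PolyLE n k →ₗ[ℝ] Module.Dual ℝ (PolyLE n k)} (hH : IsPSD H) : 0 ≤ objective P H := by
  refine Finset.sum_nonneg fun l _ => ?_
  have hdiag : (P.transpose * toMat H * P).diag l =
      H (∑ α, P α l • mono α) (∑ α, P α l • mono α) := by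
    simp only [Matrix.diag, Matrix.mul_apply, Matrix.transpose_apply, toMat, Matrix.of_apply,
      map_sum, map_smul, LinearMap.sum_apply, LinearMap.smul_apply, smul_eq_mul, Finset.mul_sum,
      Finset.sum_mul]
    exact Finset.sum_congr rfl fun _ _ => Finset.sum_congr rfl fun _ _ => by ring
  exact hdiag ▸ hH _

theorem IsProper.evalAtInfinity_quadPoly_pos {P : Matrix (Expo n k) (Expo n k) ℝ}
    (hP : IsProper P) {η : Fin n → ℝ} (hη : η ≠ 0) :
    0 < evalAtInfinity (2 * k) η ⟨quadPoly P, quadPoly_mem P⟩ := by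
  refine lt_of_le_of_ne ?_ ?_
  · rw [← objective_hankel]
    exact objective_nonneg P (isPSD_hankel_evalAtInfinity η)
  · rw [evalAtInfinity_apply]
    exact (hP η hη).symm

theorem eq_zero_or_pos_of_mem_hull {M : Type*} [AddCommGroup M] [Module ℝ M] {S : Set M}
    {ℓ : M →ₗ[ℝ] ℝ} (hS : ∀ y ∈ S, 0 < ℓ y) {x : M} (hx : x ∈ PointedCone.hull ℝ S) :
    x = 0 ∨ 0 < ℓ x := by
  induction hx using Submodule.span_induction with
  | mem y hy => exact Or.inr (hS y hy)
  | zero => exact Or.inl rfl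
  | add x y _ _ hx hy =>
    rcases hx with rfl | hx
    · rwa [zero_add]
    · rcases hy with rfl | hy
      · exact Or.inr (by rwa [add_zero])
      · exact Or.inr (map_add ℓ x y ▸ add_pos hx hy)
  | smul c x _ hx =>
    rcases hx with rfl | hx
    · exact Or.inl (smul_zero c)
    · rcases c.2.eq_or_lt with hc | hc
      · exact Or.inl (by rw [show c = 0 from Subtype.ext hc.symm, zero_smul])
      · exact Or.inr ((map_smul ℓ (c : ℝ) x).symm ▸ mul_pos hc hx)

theorem apply_eq_zero_of_mem_hull_evalAtInfinity {d : ℕ} {ν : Module.Dual ℝ (PolyLE n d)}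
    (hν : ν ∈ PointedCone.hull ℝ (evalAtInfinity d '' {0}ᶜ)) {f : PolyLE n d}
    (hf : (f : MvPolynomial (Fin n) ℝ).totalDegree < d) : ν f = 0 := by
  induction hν using Submodule.span_induction with
  | mem τ hτ =>
    obtain ⟨η, -, rfl⟩ := hτ
    rw [evalAtInfinity_apply, homogeneousComponent_eq_zero _ _ hf, map_zero]
  | zero => rfl
  | add μ ν _ _ hμ hν => rw [LinearMap.add_apply, hμ, hν, add_zero]
  | smul c ν _ hν => exact mul_eq_zero_of_right _ hν

theorem IsMinimizer.mem_hull_evalAt {P : Matrix (Expo n k) (Expo n k) ℝ}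
    {σ : Module.Dual ℝ (PolyLE n (2 * k))} (hmin : IsMinimizer i P (hankel σ)) (hP : IsProper P)
    (hdeg : degV A < 2 * k) (hrank : Module.finrank ℝ (LinearMap.range (hankel σ)) ≤ k) :
    σ ∈ PointedCone.hull ℝ (Set.range (evalAt (2 * k))) := by
  obtain ⟨hext, hpsd⟩ := hankel_mem_hankelSet_iff.1 hmin.1
  obtain ⟨μ, hμ, ν, hν, rfl⟩ := Submodule.mem_sup.1 (hpsd.mem_hull_evalAt_sup hrank)
  have hμ_ext : ExtendsMoments i μ := by
    rw [extendsMoments_iff hdeg.le] at hext ⊢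
    refine hext ▸ LinearMap.ext fun v => ?_
    have hv := (mem_restrictTotalDegree _ _ _).1 (monSpan_le (Nat.le_sub_one_of_lt hdeg) v.2)
    refine (add_eq_left.2 (apply_eq_zero_of_mem_hull_evalAtInfinity hν ?_)).symm
    exact hv.trans_lt (by omega)
  have hμ_psd : IsPSD (hankel μ) :=
    isPSD_hankel_of_mem_hull (Set.forall_mem_range.2 isPSD_hankel_evalAt) hμ
  have hle := hmin.2 _ (hankel_mem_hankelSet_iff.2 ⟨hμ_ext, hμ_psd⟩)
  rw [objective_hankel, objective_hankel, LinearMap.add_apply, add_le_iff_nonpos_right] at hle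
  have hν_pos := eq_zero_or_pos_of_mem_hull
    (ℓ := Module.Dual.eval ℝ _ ⟨quadPoly P, quadPoly_mem P⟩)
    (Set.forall_mem_image.2 fun η hη => hP.evalAtInfinity_quadPoly_pos hη) hν
  rw [hν_pos.resolve_right hle.not_gt, add_zero]
  exact hμ

end Minimizers

section Points

theorem exists_affine_separating {ι K : Type*} [Field K] {y z : ι → K} (h : y ≠ z) :
    ∃ l : MvPolynomial ι K, l.totalDegree ≤ 1 ∧ eval y l = 0 ∧ eval z l = 1 := by
  obtain ⟨j, hj⟩ := Function.ne_iff.1 h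
  refine ⟨C (z j - y j)⁻¹ * (X j - C (y j)), ?_, by simp, ?_⟩
  · rw [C_mul']
    exact (totalDegree_smul_le _ _).trans
      ((totalDegree_sub_C_le _ _).trans (totalDegree_X j).le)
  · simp [inv_mul_cancel₀ (sub_ne_zero.2 hj.symm)]

theorem exists_separating_polynomial {ι K : Type*} [Field K] {d : ℕ} {s : Finset (ι → K)}
    (hs : s.card ≤ d + 1) {z : ι → K} (hz : z ∈ s) :
    ∃ p ∈ restrictTotalDegree ι K d, eval z p = 1 ∧ ∀ y ∈ s, y ≠ z → eval y p = 0 := by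
  classical
  choose! l hl_deg hl_zero hl_one using fun y : ι → K => exists_affine_separating (y := y) (z := z)
  refine ⟨∏ y ∈ s.erase z, l y, ?_, ?_, fun y hy hyz => ?_⟩
  · rw [mem_restrictTotalDegree]
    refine (totalDegree_finsetProd _ _).trans
      ((Finset.sum_le_card_nsmul _ _ 1 fun y hy => hl_deg y (Finset.ne_of_mem_erase hy)).trans ?_)
    rw [Finset.card_erase_of_mem hz, smul_eq_mul, mul_one]
    omega
  · rw [map_prod]
    exact Finset.prod_eq_one fun y hy => hl_one y (Finset.ne_of_mem_erase hy)
  · rw [map_prod]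
    exact Finset.prod_eq_zero (Finset.mem_erase.2 ⟨hyz, hy⟩) (hl_zero y hyz)

variable {n k : ℕ}

/-- Evaluation of the polynomials of degree at most `d` at the points of `s`. -/
def evalOn (d : ℕ) (s : Finset (Fin n → ℝ)) : PolyLE n d →ₗ[ℝ] (s → ℝ) :=
  LinearMap.pi fun z => evalAt d z

theorem evalOn_apply {d : ℕ} {s : Finset (Fin n → ℝ)} (p : PolyLE n d) (z : s) :
    evalOn d s p z = eval (z : Fin n → ℝ) (p : MvPolynomial (Fin n) ℝ) :=
  evalAt_apply _ _

theorem range_evalOn {d : ℕ} {s : Finset (Fin n → ℝ)} (hs : s.card ≤ d + 1) :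
    LinearMap.range (evalOn d s) = ⊤ := by
  classical
  refine eq_top_iff.2 ((Pi.basisFun ℝ s).span_eq.ge.trans (Submodule.span_le.2 ?_))
  rintro _ ⟨z, rfl⟩
  obtain ⟨p, hp, hpz, hpy⟩ := exists_separating_polynomial hs z.2
  refine ⟨⟨p, hp⟩, funext fun y => ?_⟩
  rw [evalOn_apply, Pi.basisFun_apply]
  obtain rfl | hyz := eq_or_ne y z
  · rw [Pi.single_eq_same, hpz]
  · rw [Pi.single_eq_of_ne hyz, hpy y y.2 (Subtype.coe_ne_coe.2 hyz)]

variable {s : Finset (Fin n → ℝ)} {w : (Fin n → ℝ) → ℝ}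

theorem hankel_sum_evalAt_apply (p q : PolyLE n k) :
    hankel (∑ z ∈ s, w z • evalAt (2 * k) z) p q = ∑ z ∈ s, w z *
      (eval z (p : MvPolynomial (Fin n) ℝ) * eval z (q : MvPolynomial (Fin n) ℝ)) := by
  simp only [hankel_apply, LinearMap.sum_apply, LinearMap.smul_apply, evalAt_apply, map_mul,
    smul_eq_mul]

theorem range_hankel_sum_evalAt_le :
    LinearMap.range (hankel (∑ z ∈ s, w z • evalAt (2 * k) z)) ≤
      Submodule.span ℝ (evalAt k '' s) := by
  rintro _ ⟨p, rfl⟩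
  have heq : hankel (∑ z ∈ s, w z • evalAt (2 * k) z) p =
      ∑ z ∈ s, (w z * eval z (p : MvPolynomial (Fin n) ℝ)) • evalAt k z := LinearMap.ext fun q => by
    simp only [hankel_sum_evalAt_apply, LinearMap.sum_apply, LinearMap.smul_apply, evalAt_apply,
      smul_eq_mul, mul_assoc]
  rw [heq]
  exact Submodule.sum_mem _ fun z hz =>
    Submodule.smul_mem _ _ (Submodule.subset_span ⟨z, hz, rfl⟩)

theorem finrank_range_hankel_sum_evalAt_le :
    Module.finrank ℝ (LinearMap.range (hankel (∑ z ∈ s, w z • evalAt (2 * k) z))) ≤ s.card := by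
  classical
  refine (Submodule.finrank_mono range_hankel_sum_evalAt_le).trans ?_
  rw [← Finset.coe_image]
  exact (finrank_span_finset_le_card _).trans Finset.card_image_le

theorem ker_hankel_sum_evalAt_le {t : Finset (Fin n → ℝ)} (hts : t ⊆ s) (hw : ∀ z ∈ s, 0 < w z) :
    LinearMap.ker (hankel (∑ z ∈ s, w z • evalAt (2 * k) z)) ≤ LinearMap.ker (evalOn k t) := by
  intro p hp
  have hsum := hankel_sum_evalAt_apply (s := s) (w := w) p p
  rw [hp, LinearMap.zero_apply, eq_comm, Finset.sum_eq_zero_iff_of_nonneg fun z hz =>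
    mul_nonneg (hw z hz).le (mul_self_nonneg _)] at hsum
  refine funext fun z => (evalOn_apply p z).trans ?_
  exact mul_self_eq_zero.1 ((mul_eq_zero.1 (hsum z (hts z.2))).resolve_left (hw z (hts z.2)).ne')

theorem card_le_finrank_range_hankel_sum_evalAt {t : Finset (Fin n → ℝ)} (hts : t ⊆ s)
    (ht : t.card ≤ k + 1) (hw : ∀ z ∈ s, 0 < w z) : t.card ≤
      Module.finrank ℝ (LinearMap.range (hankel (∑ z ∈ s, w z • evalAt (2 * k) z))) := by
  have hrank_eval := LinearMap.finrank_range_add_finrank_ker (evalOn k t)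
  rw [range_evalOn ht, finrank_top, Module.finrank_fintype_fun_eq_card, Fintype.card_coe]
    at hrank_eval
  have hrank_hankel := LinearMap.finrank_range_add_finrank_ker
    (hankel (∑ z ∈ s, w z • evalAt (2 * k) z))
  have hker := Submodule.finrank_mono (ker_hankel_sum_evalAt_le (k := k) hts hw)
  omega

theorem card_eq_finrank_range_hankel_sum_evalAt (hw : ∀ z ∈ s, 0 < w z)
    (hrank : Module.finrank ℝ
      (LinearMap.range (hankel (∑ z ∈ s, w z • evalAt (2 * k) z))) ≤ k) :
    s.card = Module.finrank ℝ (LinearMap.range (hankel (∑ z ∈ s, w z • evalAt (2 * k) z))) := by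
  have hcard : s.card ≤ k + 1 := by
    by_contra! hlt
    obtain ⟨t, hts, ht⟩ := Finset.exists_subset_card_eq hlt.le
    have := card_le_finrank_range_hankel_sum_evalAt hts ht.le hw
    omega
  exact (card_le_finrank_range_hankel_sum_evalAt subset_rfl hcard hw).antisymm
    finrank_range_hankel_sum_evalAt_le

theorem exists_finset_sum_of_mem_hull_range {κ M : Type*} [AddCommGroup M] [Module ℝ M]
    {v : κ → M} {x : M} (hx : x ∈ PointedCone.hull ℝ (Set.range v)) :
    ∃ (s : Finset κ) (w : κ → ℝ), (∀ z ∈ s, 0 < w z) ∧ x = ∑ z ∈ s, w z • v z := by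
  obtain ⟨c, rfl⟩ := Finsupp.mem_span_range_iff_exists_finsupp.1 hx
  exact ⟨c.support, fun z => c z,
    fun z hz => (c z).2.lt_of_ne' (Subtype.coe_ne_coe.2 (Finsupp.mem_support_iff.1 hz)), rfl⟩

theorem exists_sum_evalAt_of_mem_hull {σ : Module.Dual ℝ (PolyLE n (2 * k))} {r : ℕ}
    (hσ : σ ∈ PointedCone.hull ℝ (Set.range (evalAt (2 * k))))
    (hrank : Module.finrank ℝ (LinearMap.range (hankel σ)) = r) (hr : r ≤ k) :
    ∃ (ω : Fin r → ℝ) (ζ : Fin r → Fin n → ℝ), (∀ j, 0 < ω j) ∧ Function.Injective ζ ∧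
      σ = ∑ j, ω j • evalAt (2 * k) (ζ j) := by
  obtain ⟨s, w, hw, rfl⟩ := exists_finset_sum_of_mem_hull_range hσ
  have hcard : s.card = r :=
    (card_eq_finrank_range_hankel_sum_evalAt hw (hrank.trans_le hr)).trans hrank
  let e : Fin r ≃ s := (s.equivFinOfCardEq hcard).symm
  refine ⟨fun j => w (e j), fun j => e j, fun j => hw _ (e j).2,
    Subtype.val_injective.comp e.injective, ?_⟩
  rw [← Finset.sum_coe_sort s, ← e.sum_comp]

end Points

end HankelCubature

end

theorem mainTheorem2 (n k r : ℕ) (A : Finset (Fin n →₀ ℕ))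
    (i : Module.Dual ℝ (HankelCubature.monSpan A))
    (P : Matrix (HankelCubature.Expo n k) (HankelCubature.Expo n k) ℝ)
    (hP : HankelCubature.IsProper P)
    (hk : ((HankelCubature.degV A : ℝ) + 1) / 2 ≤ (k : ℝ))
    (σ : Module.Dual ℝ (HankelCubature.PolyLE n (2 * k)))
    (hmin : HankelCubature.IsMinimizer i P (HankelCubature.hankel σ))
    (hrank : Module.finrank ℝ (LinearMap.range (HankelCubature.hankel σ)) = r)
    (hr : r ≤ k) :
    HankelCubature.hankel σ ∈ HankelCubature.cubatureSet i k r ∧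
    ∃ (ω : Fin r → ℝ) (ζ : Fin r → Fin n → ℝ),
      (∀ j, 0 < ω j) ∧ Function.Injective ζ ∧
      σ = ∑ j, ω j • HankelCubature.evalAt (2 * k) (ζ j) ∧
      ∀ v : HankelCubature.monSpan A,
        i v = ∑ j, ω j * MvPolynomial.eval (ζ j) (v : MvPolynomial (Fin n) ℝ) := by
  open HankelCubature in
  have hdeg : degV A < 2 * k := by
    have hcast : ((degV A + 1 : ℕ) : ℝ) ≤ (2 * k : ℕ) := by push_cast; linarith
    exact_mod_cast hcast
  obtain ⟨ω, ζ, hω, hζ, hσ⟩ :=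
    exists_sum_evalAt_of_mem_hull (hmin.mem_hull_evalAt hP hdeg (hrank.trans_le hr)) hrank hr
  refine ⟨⟨hmin.1, ω, ζ, hω, congrArg hankel hσ⟩, ω, ζ, hω, hζ, hσ, fun v => ?_⟩
  have hmoments := (extendsMoments_iff hdeg.le).1 (hankel_mem_hankelSet_iff.1 hmin.1).1
  rw [← hmoments, hσ]
  simp only [LinearMap.comp_apply, LinearMap.sum_apply, LinearMap.smul_apply, evalAt_apply,
    Submodule.coe_inclusion, smul_eq_mul]
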